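/- For $p\ge 1$ put $N=2p$. Let $I\subseteq\mathbb R$ be an interval with non-empty interior. For smooth $w_1,\dots,w_N, f$ on $I$ let $$\mathcal A_p[w_1,\dots,w_N](f)=\sum_{\sigma\in S_N}(-1)^\sigma\, w_{\sigma(1)}\partial_x^p\circ w_{\sigma(2)}\partial_x^p\circ\cdots\circ w_{\sigma(N)}\partial_x^p\,(f).$$ Let $\mathrm{const}(p)$ denote the universal constant such that, for all smooth $w_1,\dots,w_N,f$ on $I$, $$\mathcal A_p[w_1,\dots,w_N](f)=\mathrm{const}(p)\cdot\mathrm{Wronsk}(w_1,\dots,w_N)\cdot\partial_x^p f .$$ For $\sigma\in S_N$ and $1\le k\le N-1$ put $T_k=\sum_{i=N-k+1}^{N}(\sigma(i)-1-p)$ and $E_k=\sum_{j=0}^{k-1}(\sigma(N-j)-1)-(k-1)p$. Let $\Phi_p$ be the set of $\sigma\in S_N$ with $\sigma(1)=1$ and $T_k\ge 0$ for all $1\le k\le N-1$. Write $a^{\underline p}=a(a-1)\cdots(a-p+1)$. Then for $p=1,\dots,6$ the constant $\mathrm{const}(p)$ exists, is unique, and has the value listed below. The closed formula $$\Bigl(\sum_{\sigma\in\Phi_p}(-1)^\sigma\prod_{k=1}^{N-1}E_k^{\underline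 p}\Bigr)\Big/\prod_{k=0}^{N-1}k!$$ evaluates to the same number. The size of $\Phi_p$ and the numbers of even and of odd permutations in $\Phi_p$ are as follows. $$\begin{array}{c|r|r|r|r} p & |\Phi_p| & \text{even} & \text{odd} & \mathrm{const}(p)\\ \hline 1 & 1 & 1 & 0 & 1\\ 2 & 3 & 1 & 2 & 2\\ 3 & 35 & 18 & 17 & 90\\ 4 & 1001 & 500 & 501 & 586\,656\\ 5 & 53109 & 26555 & 26554 & 1\,915\,103\,977\,500\\ 6 & 4605271 & 2302635 & 2302636 & 7\,886\,133\,184\,567\,796\,056\,800 \end{array}$$ -/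

import Mathlib

open scoped ContDiff

namespace AlternatingWronskian

noncomputable section

/-- The differential operator `w ∂ₓᵖ` on the interval `I`, applied to `g`. -/
def weightedOp (I : Set ℝ) (p : ℕ) (w : ℝ → ℝ) (g : ℝ → ℝ) : ℝ → ℝ :=
  fun x => w x * iteratedDerivWithin p g I x

/-- The composition `D₀ ∘ D₁ ∘ ⋯ ∘ Dₙ₋₁` of operators on functions, applied to `f`
(the operator with the largest index acts first). -/
def composeOps {n : ℕ} (D : Fin n → (ℝ → ℝ) → (ℝ → ℝ)) (f : ℝ → ℝ) : ℝ → ℝ :=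
  (List.ofFn D).foldr (fun T g => T g) f

/-- The alternating composition
`∑_σ (-1)^σ (w_{σ(1)} ∂ₓᵖ) ∘ ⋯ ∘ (w_{σ(N)} ∂ₓᵖ) (f)` of `N = 2p` operators of order `p`. -/
def alternatingComposition (I : Set ℝ) (p : ℕ) (w : Fin (2 * p) → ℝ → ℝ) (f : ℝ → ℝ) :
    ℝ → ℝ :=
  fun x => ∑ σ : Equiv.Perm (Fin (2 * p)),
    ((Equiv.Perm.sign σ : ℤ) : ℝ) * composeOps (fun k => weightedOp I p (w (σ k))) f x

/-- The Wronskian determinant of `w₁, …, wₙ` on the interval `I`. -/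
def wronskian (I : Set ℝ) {n : ℕ} (w : Fin n → ℝ → ℝ) : ℝ → ℝ :=
  fun x => (Matrix.of fun i j : Fin n => iteratedDerivWithin (i : ℕ) (w j) I x).det

/-- `c` is a universal constant for order `p`: the alternating composition of any `N = 2p`
operators `w_j ∂ₓᵖ` with smooth coefficients on `I` is the operator `c · Wronsk(w₁, …, w_N) ∂ₓᵖ`. -/
def IsAlternationConst (I : Set ℝ) (p : ℕ) (c : ℝ) : Prop :=
  ∀ w : Fin (2 * p) → ℝ → ℝ, (∀ i, ContDiffOn ℝ ∞ (w i) I) →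
    ∀ f : ℝ → ℝ, ContDiffOn ℝ ∞ f I →
      ∀ x ∈ I, alternatingComposition I p w f x =
        c * wronskian I w x * iteratedDerivWithin p f I x

end

/-! Permutations of `{1, …, N}` are permutations of `Fin N = {0, …, N-1}` here: both the positions
and the values are shifted by one, so `(σ i : ℤ)` is the number `σ(i+1) - 1`, and the last `k`
positions are those `i : Fin N` with `N - k ≤ i`, that is `N ≤ i + k`. -/

/-- `T_k = ∑_{i = N-k+1}^{N} (σ(i) - 1 - p)`, where `N = 2p`. -/
def partialT (p : ℕ) (σ : Equiv.Perm (Fin (2 * p))) (k : ℕ) : ℤ :=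
  ∑ i ∈ Finset.univ.filter (fun i : Fin (2 * p) => 2 * p ≤ (i : ℕ) + k),
    (((σ i : ℕ) : ℤ) - (p : ℤ))

/-- `σ(1) = 1` and `T_k ≥ 0` for `1 ≤ k ≤ N - 1`. -/
def PassesFilter (p : ℕ) (σ : Equiv.Perm (Fin (2 * p))) : Prop :=
  (∀ i : Fin (2 * p), (i : ℕ) = 0 → (σ i : ℕ) = 0) ∧
    ∀ k ∈ Finset.Icc 1 (2 * p - 1), 0 ≤ partialT p σ k

instance (p : ℕ) : DecidablePred (PassesFilter p) := fun σ =>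
  inferInstanceAs (Decidable ((∀ i : Fin (2 * p), (i : ℕ) = 0 → (σ i : ℕ) = 0) ∧
    ∀ k ∈ Finset.Icc 1 (2 * p - 1), 0 ≤ partialT p σ k))

/-- The set `Φ_p` of permutations in `S_N`, `N = 2p`, with `σ(1) = 1` and `T_k ≥ 0` for
`1 ≤ k ≤ N - 1`. -/
def Phi (p : ℕ) : Finset (Equiv.Perm (Fin (2 * p))) :=
  {σ | PassesFilter p σ}

/-- `E_k = ∑_{j=0}^{k-1} (σ(N-j) - 1) - (k-1) p`, where `N = 2p`. -/
def exponentE (p : ℕ) (σ : Equiv.Perm (Fin (2 * p))) (k : ℕ) : ℤ :=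
  (∑ i ∈ Finset.univ.filter (fun i : Fin (2 * p) => 2 * p ≤ (i : ℕ) + k),
    ((σ i : ℕ) : ℤ)) - ((k : ℤ) - 1) * (p : ℤ)

/-- The falling factorial `a (a - 1) ⋯ (a - p + 1)`. -/
def fallingFactorial (a : ℤ) (p : ℕ) : ℤ :=
  ∏ i ∈ Finset.range p, (a - (i : ℤ))

/-- The closed formula
`(∑_{σ ∈ Φ_p} (-1)^σ ∏_{k=1}^{N-1} E_k (E_k - 1) ⋯ (E_k - p + 1)) / ∏_{k=0}^{N-1} k!`. -/
def closedFormula (p : ℕ) : ℚ :=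
  ((∑ σ ∈ Phi p, (Equiv.Perm.sign σ : ℤ) *
      ∏ k ∈ Finset.Icc 1 (2 * p - 1), fallingFactorial (exponentE p σ k) p : ℤ) : ℚ) /
    ((∏ k ∈ Finset.range (2 * p), k.factorial : ℕ) : ℚ)

/-- The even permutations in `Φ_p`. -/
def evenPhi (p : ℕ) : Finset (Equiv.Perm (Fin (2 * p))) :=
  {σ ∈ Phi p | Equiv.Perm.sign σ = 1}

/-- The odd permutations in `Φ_p`. -/
def oddPhi (p : ℕ) : Finset (Equiv.Perm (Fin (2 * p))) :=
  {σ ∈ Phi p | Equiv.Perm.sign σ = -1}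

end AlternatingWronskian

/-! ### Suffix weights and decision trees on sublists. -/

namespace AlternatingWronskian

/-! The value of the alternating composition at `x` depends only on finite jets at `x`, so
coefficients and argument may be replaced by Taylor polynomials centred at `x`
(`alternatingComposition_eq`). For a fixed polynomial argument it is then an alternating form in the
coefficients, determined by its values on distinct monomials `X ^ v i`; by linearity the argument
may be taken to be `X ^ b` up to a scalar. A nonzero constant term requires `∑ v i + b = N p`.
Distinct exponents have sum at least `N (N - 1) / 2 = (N - 1) p`, so `b ≤ p`, while the innermost
`∂ᵖ` kills `b < p`. Only `b = p` with `v` a permutation of `0, …, N - 1` survives, and there the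
form is proportional to the Wronskian (`composeAlternating_eq`). Evaluation on these monomials gives
the constant: each `∂ᵖ` contributes a falling factorial of `E_k`, which vanishes when `T_k < 0`, and
the Wronskian is `∏ k!`.

For the numbers, the factor of a suffix depends only on its length and sum. Splitting off the first
entry of an arrangement therefore yields a recursion over subsets (`permSum_succ`), so `(2p)!` terms
shrink to a table on `2 ^ (2p)` sublists, stored as a pruned tree that the kernel evaluates
(`permSum_val`). The same recursion without signs counts `Φ_p`. -/

/-- The product, over the nonempty suffixes `s` of a list, of `g (length s) (sum s)`. -/
def suffixWeight (g : ℕ → ℕ → ℤ) : List ℕ → ℤ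
  | [] => 1
  | a :: l => g (l.length + 1) (a + l.sum) * suffixWeight g l

/-- A function on the sublists of a fixed list, stored as a binary decision tree. -/
inductive SublistTree where
  | zero : SublistTree
  | leaf : ℤ → SublistTree
  | node : SublistTree → SublistTree → SublistTree

namespace SublistTree

/-- A leaf, pruned when its value vanishes. -/
def mkLeaf (z : ℤ) : SublistTree := if z = 0 then zero else leaf z

/-- A node, pruned when both of its branches vanish. -/
def mkNode : SublistTree → SublistTree → SublistTree
  | zero, zero => zero
  | l, r => node l r

/-- The tree `e • t`. -/
def smul (e : ℤ) : SublistTree → SublistTree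
  | zero => zero
  | leaf z => leaf (e * z)
  | node l r => node (smul e l) (smul e r)

/-- The tree `t₁ + e • t₂`. -/
def addSMul (e : ℤ) : SublistTree → SublistTree → SublistTree
  | zero, t => smul e t
  | leaf a, zero => leaf a
  | leaf a, leaf b => leaf (a + e * b)
  -- Junk value: trees representing functions over the same list never have these two shapes.
  | leaf _, node _ _ => zero
  | node l r, zero => node l r
  | node _ _, leaf _ => zero
  | node l r, node l' r' => node (addSMul e l l') (addSMul e r r')

/-- The tree of the alternating (with `e` in place of `-1`) sum over one-element deletions. -/
def deletion (e : ℤ) : SublistTree → SublistTree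
  | zero => zero
  | leaf _ => zero
  | node l r => mkNode (deletion e l) (addSMul e l (deletion e r))

/-- Multiplication of the value at each sublist by a function of its sum. -/
def scale (g : ℕ → ℤ) : SublistTree → List ℕ → ℕ → SublistTree
  | zero, _, _ => zero
  | leaf z, _, m => mkLeaf (g m * z)
  | node _ _, [], _ => zero
  | node l r, a :: u, m => mkNode (scale g l u m) (scale g r u (a + m))

/-- The tree of the indicator function of the empty sublist. -/
def init : List ℕ → SublistTree
  | [] => leaf 1
  | _ :: u => node (init u) zero

/-- The value at the full list. -/
def top : SublistTree → ℤ
  | zero => 0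
  | leaf z => z
  | node _ r => top r

/-- The tree of the sums of suffix weights over the arrangements of the sublists of length `k`. -/
def layer (e : ℤ) (g : ℕ → ℕ → ℤ) (u : List ℕ) : ℕ → SublistTree
  | 0 => init u
  | k + 1 => scale (g (k + 1)) (deletion e (layer e g u k)) u 0

end SublistTree

/-- The weight of a suffix of length `k` and sum `m` in the closed formula. -/
def exponentWeight (p k m : ℕ) : ℤ :=
  if k < 2 * p then if k * p ≤ m then ((m - (k - 1) * p).descFactorial p : ℕ) else 0 else 1

/-- The weight of a suffix of length `k` and sum `m` that detects `T_k ≥ 0`. -/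
def filterWeight (p k m : ℕ) : ℤ :=
  if k < 2 * p then if k * p ≤ m then 1 else 0 else 1

end AlternatingWronskian

/-! ### Correctness of the tree operations. -/

namespace AlternatingWronskian

/-- The sum `∑ i, e ^ i * F (s.eraseIdx i)` over the one-element deletions of a list `s`. -/
def deletionSum (e : ℤ) : (List ℕ → ℤ) → List ℕ → ℤ
  | _, [] => 0
  | F, a :: s => F s + e * deletionSum e (fun t => F (a :: t)) s

/-- The sum of suffix weights over the arrangements of a list, by iterated deletions. -/
def layerSum (e : ℤ) (g : ℕ → ℕ → ℤ) : ℕ → List ℕ → ℤ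
  | 0, l => if l = [] then 1 else 0
  | k + 1, l => g (k + 1) l.sum * deletionSum e (layerSum e g k) l

lemma deletionSum_eq_zero (e : ℤ) (s : List ℕ) (F : List ℕ → ℤ)
    (h : ∀ t, t.Sublist s → F t = 0) : deletionSum e F s = 0 := by
  induction s generalizing F with
  | nil => rfl
  | cons a s ih =>
    rw [deletionSum, h s (List.sublist_cons_self a s),
      ih _ fun t ht => h _ (ht.cons_cons a)]
    simp

namespace SublistTree

/-- The tree `t` stores the function `F` on the sublists of `u`. -/
def Represents : SublistTree → List ℕ → (List ℕ → ℤ) → Prop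
  | zero, u, F => ∀ s, s.Sublist u → F s = 0
  | leaf z, u, F => u = [] ∧ F [] = z
  | node l r, u, F =>
    ∃ a u', u = a :: u' ∧ Represents l u' F ∧ Represents r u' fun s => F (a :: s)

lemma Represents.mkLeaf {z : ℤ} {F : List ℕ → ℤ} (h : F [] = z) :
    (mkLeaf z).Represents [] F := by
  unfold SublistTree.mkLeaf
  split_ifs with hz
  · intro s hs
    rw [List.sublist_nil.1 hs, h, hz]
  · exact ⟨rfl, h⟩

lemma Represents.mkNode {l r : SublistTree} {a : ℕ} {u : List ℕ} {F : List ℕ → ℤ}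
    (hl : l.Represents u F) (hr : r.Represents u fun s => F (a :: s)) :
    (mkNode l r).Represents (a :: u) F := by
  unfold SublistTree.mkNode
  split
  · intro s hs
    rcases List.sublist_cons_iff.1 hs with h | ⟨s, rfl, h⟩
    · exact hl s h
    · exact hr s h
  · exact ⟨a, u, rfl, hl, hr⟩

lemma Represents.congr {t : SublistTree} {u : List ℕ} {F G : List ℕ → ℤ}
    (h : t.Represents u F) (hFG : ∀ s, F s = G s) : t.Represents u G := by
  rwa [← funext hFG]

lemma Represents.smul (e : ℤ) {t : SublistTree} {u : List ℕ} {F : List ℕ → ℤ}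
    (h : t.Represents u F) : (smul e t).Represents u fun s => e * F s := by
  induction t generalizing u F with
  | zero => intro s hs; simp [h s hs]
  | leaf z => exact ⟨h.1, congrArg (e * ·) h.2⟩
  | node l r ihl ihr =>
    obtain ⟨a, u, rfl, hl, hr⟩ := h
    exact ⟨a, u, rfl, ihl hl, ihr hr⟩

lemma Represents.add_smul_zero (e : ℤ) {t : SublistTree} {u : List ℕ} {F G : List ℕ → ℤ}
    (h : t.Represents u F) (hG : ∀ s, s.Sublist u → G s = 0) :
    t.Represents u fun s => F s + e * G s := by
  induction t generalizing u F G with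
  | zero => intro s hs; simp [h s hs, hG s hs]
  | leaf z => exact ⟨h.1, by simp [h.2, hG [] (List.nil_sublist u)]⟩
  | node l r ihl ihr =>
    obtain ⟨a, u, rfl, hl, hr⟩ := h
    exact ⟨a, u, rfl, ihl hl fun s hs => hG s (hs.cons a),
      ihr hr fun s hs => hG _ (hs.cons_cons a)⟩

lemma Represents.addSMul (e : ℤ) {t₁ t₂ : SublistTree} {u : List ℕ} {F G : List ℕ → ℤ}
    (h₁ : t₁.Represents u F) (h₂ : t₂.Represents u G) :
    (addSMul e t₁ t₂).Represents u fun s => F s + e * G s := by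
  induction t₁ generalizing t₂ u F G with
  | zero =>
    have hz : ∀ (t : SublistTree) (u : List ℕ) (F G : List ℕ → ℤ),
        t.Represents u G → (∀ s, s.Sublist u → F s = 0) → t.Represents u fun s => F s + G s := by
      intro t u F G h hF
      exact (h.add_smul_zero 1 hF).congr fun s => by ring
    have := hz _ u F _ (h₂.smul e) h₁
    cases t₂ <;> exact this
  | leaf z =>
    obtain ⟨rfl, hz⟩ := h₁
    cases t₂ with
    | zero => exact Represents.add_smul_zero e (t := .leaf z) ⟨rfl, hz⟩ h₂
    | leaf w => exact ⟨rfl, by simp only [hz, h₂.2]⟩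
    | node l r => obtain ⟨a, u, h, -⟩ := h₂; cases h
  | node l r ihl ihr =>
    cases t₂ with
    | zero => exact h₁.add_smul_zero e h₂
    | leaf w => obtain ⟨a, u, rfl, -⟩ := h₁; cases h₂.1
    | node l' r' =>
      obtain ⟨a, u, rfl, hl, hr⟩ := h₁
      obtain ⟨b, v, h, hl', hr'⟩ := h₂
      cases h
      exact ⟨a, u, rfl, ihl hl hl', ihr hr hr'⟩

/-- On sublists avoiding the head `a`, deletions stay in the left branch. On `a :: s`, one either
deletes `a`, landing in the left branch, or deletes inside `s` at the cost of a factor `e`. -/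
lemma Represents.deletion (e : ℤ) {t : SublistTree} {u : List ℕ} {F : List ℕ → ℤ}
    (h : t.Represents u F) : (deletion e t).Represents u (deletionSum e F) := by
  induction t generalizing u F with
  | zero => exact fun s hs => deletionSum_eq_zero e s F fun t ht => h t (ht.trans hs)
  | leaf z =>
    obtain ⟨rfl, -⟩ := h
    intro s hs
    rw [List.sublist_nil.1 hs]
    rfl
  | node l r ihl ihr =>
    obtain ⟨a, u, rfl, hl, hr⟩ := h
    exact (ihl hl).mkNode (hl.addSMul e (ihr hr))

lemma Represents.scale (g : ℕ → ℤ) {t : SublistTree} {u : List ℕ} {F : List ℕ → ℤ} (m : ℕ)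
    (h : t.Represents u F) : (scale g t u m).Represents u fun s => g (s.sum + m) * F s := by
  induction t generalizing u F m with
  | zero => intro s hs; simp [h s hs]
  | leaf z =>
    obtain ⟨rfl, h⟩ := h
    exact Represents.mkLeaf (by simp [h])
  | node l r ihl ihr =>
    obtain ⟨a, u, rfl, hl, hr⟩ := h
    refine Represents.mkNode (ihl m hl) ((ihr (a + m) hr).congr fun s => ?_)
    rw [List.sum_cons, show s.sum + (a + m) = a + s.sum + m by ring]

lemma represents_init (u : List ℕ) :
    (init u).Represents u fun l => if l = [] then 1 else 0 := by
  induction u with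
  | nil => exact ⟨rfl, rfl⟩
  | cons a u ih => exact ⟨a, u, rfl, ih, fun s _ => by simp⟩

lemma represents_layer (e : ℤ) (g : ℕ → ℕ → ℤ) (u : List ℕ) (k : ℕ) :
    (layer e g u k).Represents u (layerSum e g k) := by
  induction k with
  | zero => exact represents_init u
  | succ k ih => exact (ih.deletion e).scale (g (k + 1)) 0

lemma Represents.eq_top {t : SublistTree} {u : List ℕ} {F : List ℕ → ℤ} (h : t.Represents u F) :
    F u = t.top := by
  induction t generalizing u F with
  | zero => exact h u (List.Sublist.refl u)
  | leaf z => obtain ⟨rfl, h⟩ := h; exact h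
  | node l r _ ihr => obtain ⟨a, u, rfl, -, hr⟩ := h; exact ihr (F := fun s => F (a :: s)) hr

end SublistTree

/-! ### Sums over permutations as iterated deletions. -/

open Equiv

/-- Precomposition with `a.succAbove` deletes the entry at position `a`; each step past the head
supplies one factor `e`. -/
lemma deletionSum_ofFn (e : ℤ) {n : ℕ} (F : List ℕ → ℤ) (v : Fin (n + 1) → ℕ) :
    deletionSum e F (List.ofFn v) =
      ∑ a : Fin (n + 1), e ^ (a : ℕ) * F (List.ofFn fun i => v (a.succAbove i)) := by
  induction n generalizing F with
  | zero => simp [deletionSum]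
  | succ n ih =>
    rw [List.ofFn_succ, deletionSum, ih, Fin.sum_univ_succ (n := n + 1), Finset.mul_sum]
    simp only [Fin.val_zero, pow_zero, one_mul, Fin.zero_succAbove, Fin.val_succ]
    congr 1
    refine Finset.sum_congr rfl fun a _ => ?_
    rw [List.ofFn_succ (f := fun i => v (a.succ.succAbove i))]
    simp only [Fin.succ_succAbove_zero, Fin.succ_succAbove_succ]
    ring

/-- The sum of `s (sign σ)` times the suffix weight of `v ∘ σ`, over all permutations `σ`. -/
def permSum (s : ℤˣ →* ℤˣ) (g : ℕ → ℕ → ℤ) {n : ℕ} (v : Fin n → ℕ) : ℤ :=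
  ∑ σ : Perm (Fin n), ((s (Perm.sign σ) : ℤˣ) : ℤ) * suffixWeight g (List.ofFn fun i => v (σ i))

/-- A permutation of `Fin (n + 1)` is the image `a` of `0` followed by a permutation of the
remaining values. -/
lemma sum_perm_fin_succ {n : ℕ} (f : Perm (Fin (n + 1)) → ℤ) :
    ∑ σ, f σ = ∑ a : Fin (n + 1), ∑ τ : Perm (Fin n),
      f (a.cycleRange.symm * Perm.decomposeFin.symm (0, τ)) := by
  rw [← Fintype.sum_prod_type']
  symm
  refine Fintype.sum_bijective
    (fun x : Fin (n + 1) × Perm (Fin n) => x.1.cycleRange.symm * Perm.decomposeFin.symm (0, x.2))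
    ?_ _ _ fun x => rfl
  -- The product sends `0` to `a`, which gives injectivity; surjectivity is the count `(n + 1) * n!
  -- = (n + 1)!`.
  rw [Fintype.bijective_iff_injective_and_card]
  constructor
  · rintro ⟨a, τ⟩ ⟨b, ρ⟩ h
    have h0 : a = b := by simpa using congrArg (fun σ : Perm (Fin (n + 1)) => σ 0) h
    subst h0
    have h1 := Perm.decomposeFin.symm.injective (mul_left_cancel h)
    simpa using h1
  · simp [Fintype.card_perm, Nat.factorial_succ]

/-- The longest suffix is the whole arrangement, whose sum does not depend on `σ`, so its weight
factors out. Fixing `σ 0 = a` leaves an arrangement of the other values, and the cycle moving `a` to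
the front has sign `(-1) ^ a`. -/
lemma permSum_succ (s : ℤˣ →* ℤˣ) (g : ℕ → ℕ → ℤ) {n : ℕ} (v : Fin (n + 1) → ℕ) :
    permSum s g v = g (n + 1) (∑ i, v i) *
      ∑ a : Fin (n + 1), ((s (-1) : ℤˣ) : ℤ) ^ (a : ℕ) *
        permSum s g fun i => v (a.succAbove i) := by
  rw [permSum, sum_perm_fin_succ, Finset.mul_sum]
  refine Finset.sum_congr rfl fun a _ => ?_
  rw [permSum, Finset.mul_sum, Finset.mul_sum]
  refine Finset.sum_congr rfl fun τ _ => ?_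
  set σ := a.cycleRange.symm * Perm.decomposeFin.symm (0, τ) with hσ
  have h0 : σ 0 = a := by simp [hσ]
  have hs : ∀ i, σ (Fin.succ i) = a.succAbove (τ i) := fun i => by simp [hσ]
  have hsign : Perm.sign σ = (-1) ^ (a : ℕ) * Perm.sign τ := by
    rw [hσ, Perm.sign_mul, Perm.sign_symm, Fin.sign_cycleRange]
    simp
  rw [List.ofFn_succ, suffixWeight, hsign]
  simp only [hs]
  have hsum : v (σ 0) + (List.ofFn fun i => v (a.succAbove (τ i))).sum = ∑ i, v i := by
    rw [List.sum_ofFn, ← Equiv.sum_comp σ v, Fin.sum_univ_succ]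
    simp only [hs]
  rw [hsum, List.length_ofFn]
  simp only [map_mul, map_pow, Units.val_mul, Units.val_pow_eq_pow_val]
  ring

lemma permSum_eq_layerSum (s : ℤˣ →* ℤˣ) (g : ℕ → ℕ → ℤ) {n : ℕ} (v : Fin n → ℕ) :
    permSum s g v = layerSum ((s (-1) : ℤˣ) : ℤ) g n (List.ofFn v) := by
  induction n with
  | zero => simp [permSum, layerSum, suffixWeight]
  | succ n ih =>
    rw [permSum_succ, layerSum, deletionSum_ofFn, List.sum_ofFn]
    simp only [ih]

/-- Makes the sums computable: the identity `s` gives the signed sum, the trivial `s` the unsigned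
one. -/
lemma permSum_val (s : ℤˣ →* ℤˣ) (g : ℕ → ℕ → ℤ) (n : ℕ) :
    permSum s g (fun i : Fin n => (i : ℕ)) =
      (SublistTree.layer ((s (-1) : ℤˣ) : ℤ) g (List.range n) n).top := by
  rw [permSum_eq_layerSum, ← (SublistTree.represents_layer _ g (List.range n) n).eq_top]
  congr 1
  simp [List.ofFn_eq_map]

end AlternatingWronskian

/-! ### Suffix sums, the filter `Φ_p` and the closed formula. -/

namespace AlternatingWronskian
open Equiv

/-- The sum of the last `k` values of `v`. -/
def suffixSum {n : ℕ} (v : Fin n → ℕ) (k : ℕ) : ℕ :=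
  ∑ i ∈ Finset.univ.filter (fun i : Fin n => n ≤ (i : ℕ) + k), v i

lemma suffixSum_self {n : ℕ} (v : Fin n → ℕ) : suffixSum v n = ∑ i, v i := by
  simp [suffixSum]

lemma suffixSum_succ {n k : ℕ} (v : Fin (n + 1) → ℕ) (hk : k ≤ n) :
    suffixSum v k = suffixSum (fun i => v i.succ) k := by
  rw [suffixSum, suffixSum, Finset.sum_filter, Finset.sum_filter, Fin.sum_univ_succ,
    if_neg (by simp; omega), zero_add]
  refine Finset.sum_congr rfl fun i _ => ?_
  simp only [Fin.val_succ]
  congr 1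
  simp only [eq_iff_iff]
  omega

/-- Counts the last `k` positions, hence the terms `-p` in `T_k`. -/
lemma suffixSum_one {n k : ℕ} (hk : k ≤ n) : suffixSum (fun _ : Fin n => 1) k = k := by
  induction n with
  | zero => simp [suffixSum]; omega
  | succ n ih =>
    rcases hk.eq_or_lt with rfl | hk
    · simp [suffixSum_self]
    · rw [suffixSum_succ _ (by omega), ih (by omega)]

lemma suffixWeight_ofFn (g : ℕ → ℕ → ℤ) {n : ℕ} (v : Fin n → ℕ) :
    suffixWeight g (List.ofFn v) = ∏ k ∈ Finset.Icc 1 n, g k (suffixSum v k) := by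
  induction n with
  | zero => simp [suffixWeight]
  | succ n ih =>
    rw [List.ofFn_succ, suffixWeight, ih, Finset.prod_Icc_succ_top (by omega), mul_comm,
      suffixSum_self, Fin.sum_univ_succ, List.sum_ofFn, List.length_ofFn]
    congr 1
    refine Finset.prod_congr rfl fun k hk => ?_
    rw [suffixSum_succ v (Finset.mem_Icc.1 hk).2]

variable {p : ℕ} (σ : Perm (Fin (2 * p)))

lemma sum_filter_coe (k : ℕ) :
    ∑ i ∈ Finset.univ.filter (fun i : Fin (2 * p) => 2 * p ≤ (i : ℕ) + k), ((σ i : ℕ) : ℤ) =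
      (suffixSum (fun i => (σ i : ℕ)) k : ℤ) := by
  simp [suffixSum]

lemma partialT_eq {k : ℕ} (hk : k ≤ 2 * p) :
    partialT p σ k = (suffixSum (fun i => (σ i : ℕ)) k : ℤ) - ((k * p : ℕ) : ℤ) := by
  have h := suffixSum_one hk
  rw [suffixSum, Finset.sum_const, smul_eq_mul, mul_one] at h
  rw [partialT, Finset.sum_sub_distrib, sum_filter_coe, Finset.sum_const, h]
  simp

lemma exponentE_eq {k : ℕ} (hk : 1 ≤ k) (h : k * p ≤ suffixSum (fun i => (σ i : ℕ)) k) :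
    exponentE p σ k = ((suffixSum (fun i => (σ i : ℕ)) k - (k - 1) * p : ℕ) : ℤ) := by
  obtain ⟨k, rfl⟩ := Nat.exists_eq_add_of_le' hk
  have h' : (k + 1 - 1) * p ≤ suffixSum (fun i => (σ i : ℕ)) (k + 1) :=
    (Nat.mul_le_mul_right p (by omega)).trans h
  rw [exponentE, sum_filter_coe, Nat.cast_sub h']
  push_cast [Nat.add_sub_cancel]
  ring

lemma fallingFactorial_natCast {a p : ℕ} (h : p ≤ a) :
    fallingFactorial (a : ℤ) p = (a.descFactorial p : ℤ) := by
  rw [fallingFactorial, Nat.descFactorial_eq_prod_range, Nat.cast_prod]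
  refine Finset.prod_congr rfl fun i hi => ?_
  rw [Nat.cast_sub ((Finset.mem_range.1 hi).le.trans h)]

lemma two_mul_sum_fin (n : ℕ) : (∑ i : Fin n, (i : ℕ)) * 2 = n * (n - 1) := by
  rw [Fin.sum_univ_eq_sum_range fun i => i, Finset.sum_range_id_mul_two]

lemma sum_fin_two_mul (p : ℕ) : ∑ i : Fin (2 * p), (i : ℕ) = (2 * p - 1) * p := by
  have h := two_mul_sum_fin (2 * p)
  have : 2 * p * (2 * p - 1) = (2 * p - 1) * p * 2 := by ring
  omega

/-- The condition `σ(1) = 1` is redundant: all values sum to `(2p - 1) p`, so the inequality at `k =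
2p - 1` leaves `0` for the first value. -/
lemma passesFilter_iff :
    PassesFilter p σ ↔
      ∀ k ∈ Finset.Icc 1 (2 * p - 1), k * p ≤ suffixSum (fun i => (σ i : ℕ)) k := by
  have key : (∀ k ∈ Finset.Icc 1 (2 * p - 1), 0 ≤ partialT p σ k) ↔
      ∀ k ∈ Finset.Icc 1 (2 * p - 1), k * p ≤ suffixSum (fun i => (σ i : ℕ)) k := by
    refine forall₂_congr fun k hk => ?_
    rw [Finset.mem_Icc] at hk
    rw [partialT_eq σ (by omega), sub_nonneg, Nat.cast_le]
  rw [PassesFilter, key, and_iff_right_iff_imp]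
  intro h i hi
  have hp : 0 < p := by have := i.2; omega
  have h1 := h (2 * p - 1) (Finset.mem_Icc.2 (by omega))
  have h2 : (σ i : ℕ) + suffixSum (fun i => (σ i : ℕ)) (2 * p - 1) = (2 * p - 1) * p := by
    rw [← sum_fin_two_mul, ← Equiv.sum_comp σ, ← Finset.add_sum_erase _ _ (Finset.mem_univ i),
      suffixSum]
    congr 2
    ext j
    simp only [Finset.mem_filter, Finset.mem_univ, true_and, Finset.mem_erase, and_true, ne_eq,
      Fin.ext_iff]
    omega
  omega

lemma suffixWeight_perm (hp : 1 ≤ p) (f w : ℕ → ℕ → ℤ)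
    (hw : ∀ k m, w k m = if k < 2 * p then if k * p ≤ m then f k m else 0 else 1) :
    suffixWeight w (List.ofFn fun i => (σ i : ℕ)) =
      if PassesFilter p σ then
        ∏ k ∈ Finset.Icc 1 (2 * p - 1), f k (suffixSum (fun i => (σ i : ℕ)) k) else 0 := by
  have h1 : 2 * p = 2 * p - 1 + 1 := by omega
  have h2 : Finset.Icc 1 (2 * p) = insert (2 * p) (Finset.Icc 1 (2 * p - 1)) := by
    ext k; simp only [Finset.mem_Icc, Finset.mem_insert]; omega
  -- The whole list is also a suffix, of length `2p`, but the formula stops at `2p - 1`; its weight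
  -- is `1`.
  rw [suffixWeight_ofFn, h2, Finset.prod_insert (by simp; omega), hw (2 * p),
    if_neg (lt_irrefl _), one_mul]
  have h3 : ∀ k ∈ Finset.Icc 1 (2 * p - 1), k < 2 * p := fun k hk => by
    rw [Finset.mem_Icc] at hk; omega
  split_ifs with h
  · rw [passesFilter_iff] at h
    exact Finset.prod_congr rfl fun k hk => by rw [hw, if_pos (h3 k hk), if_pos (h k hk)]
  · rw [passesFilter_iff] at h
    push Not at h
    obtain ⟨k, hk, hlt⟩ := h
    exact Finset.prod_eq_zero hk (by rw [hw, if_pos (h3 k hk), if_neg (by omega)])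

lemma permSum_exponentWeight (hp : 1 ≤ p) :
    permSum (MonoidHom.id ℤˣ) (exponentWeight p) (fun i : Fin (2 * p) => (i : ℕ)) =
      ∑ σ ∈ Phi p, (Perm.sign σ : ℤ) *
        ∏ k ∈ Finset.Icc 1 (2 * p - 1), fallingFactorial (exponentE p σ k) p := by
  rw [permSum, Phi, Finset.sum_filter]
  refine Finset.sum_congr rfl fun σ _ => ?_
  rw [suffixWeight_perm σ hp (fun k m => ((m - (k - 1) * p).descFactorial p : ℤ))
    (exponentWeight p) fun k m => rfl]
  split_ifs with h
  · rw [MonoidHom.id_apply]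
    congr 1
    refine Finset.prod_congr rfl fun k hk => ?_
    have hk1 := (Finset.mem_Icc.1 hk).1
    have hm := (passesFilter_iff σ).1 h k hk
    rw [exponentE_eq σ hk1 hm, fallingFactorial_natCast]
    obtain ⟨k, rfl⟩ := Nat.exists_eq_add_of_le' hk1
    rw [Nat.add_sub_cancel]
    rw [add_mul, one_mul] at hm
    omega
  · simp

lemma permSum_filterWeight (hp : 1 ≤ p) (s : ℤˣ →* ℤˣ) :
    permSum s (filterWeight p) (fun i : Fin (2 * p) => (i : ℕ)) =
      ∑ σ ∈ Phi p, ((s (Perm.sign σ) : ℤˣ) : ℤ) := by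
  rw [permSum, Phi, Finset.sum_filter]
  refine Finset.sum_congr rfl fun σ _ => ?_
  rw [suffixWeight_perm σ hp (fun _ _ => 1) (filterWeight p) fun k m => rfl]
  simp

lemma closedFormula_eq (hp : 1 ≤ p) {c : ℕ}
    (h : (SublistTree.layer (-1) (exponentWeight p) (List.range (2 * p)) (2 * p)).top =
      ((c * ∏ k ∈ Finset.range (2 * p), k.factorial : ℕ) : ℤ)) :
    closedFormula p = c := by
  have h' := permSum_val (MonoidHom.id ℤˣ) (exponentWeight p) (2 * p)
  rw [permSum_exponentWeight hp] at h'
  rw [closedFormula, h']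
  have h0 : ((∏ k ∈ Finset.range (2 * p), k.factorial : ℕ) : ℚ) ≠ 0 := by
    exact_mod_cast (Finset.prod_pos fun k _ => Nat.factorial_pos k).ne'
  rw [div_eq_iff h0]
  simp only [MonoidHom.id_apply, Units.val_neg, Units.val_one] at h ⊢
  rw [h]
  push_cast
  rfl

/-- The unsigned sum is even plus odd, the signed sum even minus odd; together they determine both
counts. -/
lemma card_phi_eq (hp : 1 ≤ p) {a b : ℕ}
    (h₁ : (SublistTree.layer 1 (filterWeight p) (List.range (2 * p)) (2 * p)).top =
      ((a + b : ℕ) : ℤ))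
    (h₂ : (SublistTree.layer (-1) (filterWeight p) (List.range (2 * p)) (2 * p)).top = a - b) :
    (Phi p).card = a + b ∧ (evenPhi p).card = a ∧ (oddPhi p).card = b := by
  have e₁ := permSum_val 1 (filterWeight p) (2 * p)
  have e₂ := permSum_val (MonoidHom.id ℤˣ) (filterWeight p) (2 * p)
  rw [permSum_filterWeight hp] at e₁ e₂
  simp only [MonoidHom.id_apply, MonoidHom.one_apply, Units.val_neg, Units.val_one] at e₁ e₂
  rw [h₁, Finset.sum_const, nsmul_eq_mul, mul_one, Nat.cast_inj] at e₁
  rw [h₂] at e₂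
  have hodd : oddPhi p = (Phi p).filter fun σ => ¬ Perm.sign σ = 1 := by
    refine Finset.filter_congr fun σ _ => ?_
    rcases Int.units_eq_one_or (Perm.sign σ) with h | h <;> simp [h]
  have hcard : (evenPhi p).card + (oddPhi p).card = (Phi p).card := by
    rw [hodd, evenPhi]
    exact Finset.card_filter_add_card_filter_not _
  have hsum : ∑ σ ∈ Phi p, (Perm.sign σ : ℤ) = (evenPhi p).card - (oddPhi p).card := by
    rw [← Finset.sum_filter_add_sum_filter_not (Phi p) fun σ => Perm.sign σ = 1, ← hodd,
      ← evenPhi]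
    rw [Finset.sum_congr rfl fun σ hσ => show (Perm.sign σ : ℤ) = 1 by
      rw [(Finset.mem_filter.1 hσ).2, Units.val_one],
      Finset.sum_congr (s₁ := oddPhi p) rfl fun σ hσ => show (Perm.sign σ : ℤ) = -1 by
        rw [(Finset.mem_filter.1 hσ).2, Units.val_neg, Units.val_one]]
    simp
    ring
  omega

end AlternatingWronskian

/-! ### Reduction from smooth functions to polynomials. -/

namespace AlternatingWronskian
open Polynomial

/-- The operator `P ∂ᵖ` on polynomials. -/
noncomputable def polyOp (p : ℕ) : ℝ[X] →ₗ[ℝ] Module.End ℝ ℝ[X] :=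
  LinearMap.mulRight ℝ (derivative ^ p : Module.End ℝ ℝ[X]) ∘ₗ LinearMap.mul ℝ ℝ[X]

lemma polyOp_apply (p : ℕ) (P Q : ℝ[X]) : polyOp p P Q = P * derivative^[p] Q := by
  simp [polyOp, Module.End.pow_apply]

/-- The composition `P₀ ∂ᵖ ∘ ⋯ ∘ Pₙ₋₁ ∂ᵖ`, applied to `Q`. -/
noncomputable def polyCompose (p : ℕ) {n : ℕ} (P : Fin n → ℝ[X]) (Q : ℝ[X]) : ℝ[X] :=
  (List.ofFn fun k => polyOp p (P k)).prod Q

lemma polyCompose_zero (p : ℕ) (P : Fin 0 → ℝ[X]) (Q : ℝ[X]) : polyCompose p P Q = Q := by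
  simp [polyCompose]

lemma polyCompose_succ (p : ℕ) {n : ℕ} (P : Fin (n + 1) → ℝ[X]) (Q : ℝ[X]) :
    polyCompose p P Q = P 0 * derivative^[p] (polyCompose p (fun k => P k.succ) Q) := by
  rw [polyCompose, List.ofFn_succ, List.prod_cons, Module.End.mul_apply, polyOp_apply]
  rfl

lemma composeOps_succ {n : ℕ} (D : Fin (n + 1) → (ℝ → ℝ) → (ℝ → ℝ)) (f : ℝ → ℝ) :
    composeOps D f = D 0 (composeOps (fun k => D k.succ) f) := by
  rw [composeOps, List.ofFn_succ, List.foldr_cons]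
  rfl

variable {I : Set ℝ} {p : ℕ} {x : ℝ} {g h w w' : ℝ → ℝ}

lemma iteratedDerivWithin_iteratedDerivWithin (k p : ℕ) (g : ℝ → ℝ) :
    iteratedDerivWithin k (iteratedDerivWithin p g I) I = iteratedDerivWithin (k + p) g I := by
  ext t
  rw [iteratedDerivWithin_eq_iterate, iteratedDerivWithin_eq_iterate, Function.iterate_add_apply]
  have h : iteratedDerivWithin p g I = (fun g => derivWithin g I)^[p] g :=
    _root_.funext fun s => iteratedDerivWithin_eq_iterate
  rw [h]

lemma contDiffOn_iteratedDerivWithin (hI : UniqueDiffOn ℝ I) (hg : ContDiffOn ℝ ∞ g I) (p : ℕ) :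
    ContDiffOn ℝ ∞ (iteratedDerivWithin p g I) I := by
  induction p with
  | zero => simpa using hg
  | succ p ih =>
    refine (ih.derivWithin hI (m := ∞) (by simp)).congr fun t _ => ?_
    rw [iteratedDerivWithin_succ]

lemma contDiffOn_weightedOp (hI : UniqueDiffOn ℝ I) (hw : ContDiffOn ℝ ∞ w I)
    (hg : ContDiffOn ℝ ∞ g I) (p : ℕ) : ContDiffOn ℝ ∞ (weightedOp I p w g) I :=
  hw.mul (contDiffOn_iteratedDerivWithin hI hg p)

lemma contDiffOn_composeOps (hI : UniqueDiffOn ℝ I) {n : ℕ} {v : Fin n → ℝ → ℝ}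
    (hv : ∀ i, ContDiffOn ℝ ∞ (v i) I) (hg : ContDiffOn ℝ ∞ g I) (p : ℕ) :
    ContDiffOn ℝ ∞ (composeOps (fun k => weightedOp I p (v k)) g) I := by
  induction n with
  | zero => simpa [composeOps] using hg
  | succ n ih =>
    rw [composeOps_succ]
    exact contDiffOn_weightedOp hI (hv 0) (ih fun i => hv i.succ) p

/-- The derivatives within `I` of order less than `m` of two functions agree at `x`. -/
def JetEq (I : Set ℝ) (x : ℝ) (m : ℕ) (g h : ℝ → ℝ) : Prop :=
  ∀ k < m, iteratedDerivWithin k g I x = iteratedDerivWithin k h I x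

lemma JetEq.mono {m n : ℕ} (hgh : JetEq I x n g h) (hmn : m ≤ n) : JetEq I x m g h :=
  fun k hk => hgh k (hk.trans_le hmn)

/-- By the Leibniz rule, the derivative of order `k` of `w ∂ᵖ g` involves `w` up to order `k` and
`g` up to order `k + p`. Each operator thus costs `p` orders of the jet. -/
lemma JetEq.weightedOp (hI : UniqueDiffOn ℝ I) (hx : x ∈ I) {m : ℕ}
    (hw : ContDiffOn ℝ ∞ w I) (hw' : ContDiffOn ℝ ∞ w' I)
    (hg : ContDiffOn ℝ ∞ g I) (hh : ContDiffOn ℝ ∞ h I)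
    (hww : JetEq I x m w w') (hgh : JetEq I x (m + p) g h) :
    JetEq I x m (weightedOp I p w g) (weightedOp I p w' h) := by
  intro k hk
  have key : ∀ u f : ℝ → ℝ, ContDiffOn ℝ ∞ u I → ContDiffOn ℝ ∞ f I →
      iteratedDerivWithin k (AlternatingWronskian.weightedOp I p u f) I x =
        ∑ i ∈ Finset.range (k + 1), k.choose i * iteratedDerivWithin i u I x *
          iteratedDerivWithin (k - i + p) f I x := by
    intro u f hu hf
    have e : AlternatingWronskian.weightedOp I p u f = u * iteratedDerivWithin p f I := rfl
    rw [e, iteratedDerivWithin_mul hx hI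
      ((hu x hx).of_le (by exact_mod_cast le_top))
      ((contDiffOn_iteratedDerivWithin hI hf p x hx).of_le (by exact_mod_cast le_top))]
    simp only [iteratedDerivWithin_iteratedDerivWithin]
  rw [key w g hw hg, key w' h hw' hh]
  refine Finset.sum_congr rfl fun i hi => ?_
  rw [Finset.mem_range] at hi
  rw [hww i (by omega), hgh (k - i + p) (by omega)]

lemma JetEq.composeOps (hI : UniqueDiffOn ℝ I) (hx : x ∈ I) {n m : ℕ} {v v' : Fin n → ℝ → ℝ}
    (hv : ∀ i, ContDiffOn ℝ ∞ (v i) I) (hv' : ∀ i, ContDiffOn ℝ ∞ (v' i) I)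
    (hg : ContDiffOn ℝ ∞ g I) (hh : ContDiffOn ℝ ∞ h I)
    (hvv : ∀ i, JetEq I x (m + n * p) (v i) (v' i)) (hgh : JetEq I x (m + n * p) g h) :
    JetEq I x m (composeOps (fun k => AlternatingWronskian.weightedOp I p (v k)) g)
      (composeOps (fun k => AlternatingWronskian.weightedOp I p (v' k)) h) := by
  induction n generalizing m with
  | zero => simpa [AlternatingWronskian.composeOps] using hgh
  | succ n ih =>
    rw [composeOps_succ, composeOps_succ]
    have e : m + (n + 1) * p = m + p + n * p := by ring
    refine JetEq.weightedOp hI hx (hv 0) (hv' 0)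
      (contDiffOn_composeOps hI (fun i => hv i.succ) hg p)
      (contDiffOn_composeOps hI (fun i => hv' i.succ) hh p)
      ((hvv 0).mono (Nat.le_add_right _ _)) ?_
    exact ih (fun i => hv i.succ) (fun i => hv' i.succ) (fun i => e ▸ hvv i.succ) (e ▸ hgh)

/-- The polynomial function `t ↦ P (t - x)`. -/
noncomputable def polyAt (x : ℝ) (P : ℝ[X]) : ℝ → ℝ := fun t => P.eval (t - x)

lemma contDiff_polyAt (x : ℝ) (P : ℝ[X]) : ContDiff ℝ ∞ (polyAt x P) := by
  have : polyAt x P = fun t => aeval (t - x) P := by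
    ext t; simp [polyAt, aeval_def, eval₂_eq_eval_map]
  rw [this]
  exact (P.contDiff_aeval ∞).comp (contDiff_id.sub contDiff_const)

lemma hasDerivAt_polyAt (x : ℝ) (P : ℝ[X]) (t : ℝ) :
    HasDerivAt (polyAt x P) (polyAt x (derivative P) t) t := by
  have h := (P.hasDerivAt (t - x)).comp t ((hasDerivAt_id t).sub_const x)
  rw [mul_one] at h
  exact h

lemma iteratedDerivWithin_polyAt (hI : UniqueDiffOn ℝ I) (x : ℝ) (P : ℝ[X]) (k : ℕ) :
    Set.EqOn (iteratedDerivWithin k (polyAt x P) I) (polyAt x (derivative^[k] P)) I := by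
  induction k with
  | zero => intro t _; simp
  | succ k ih =>
    intro t ht
    rw [iteratedDerivWithin_succ, derivWithin_congr ih (ih ht), Function.iterate_succ_apply']
    exact (hasDerivAt_polyAt x _ t).hasDerivWithinAt.derivWithin (hI t ht)

lemma iteratedDerivWithin_polyAt_self (hI : UniqueDiffOn ℝ I) (hx : x ∈ I) (P : ℝ[X]) (k : ℕ) :
    iteratedDerivWithin k (polyAt x P) I x = k.factorial * P.coeff k := by
  rw [iteratedDerivWithin_polyAt hI x P k hx, polyAt, sub_self, ← coeff_zero_eq_eval_zero,
    coeff_iterate_derivative, zero_add, Nat.descFactorial_self, nsmul_eq_mul]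

lemma composeOps_polyAt (hI : UniqueDiffOn ℝ I) (x : ℝ) {n : ℕ} (P : Fin n → ℝ[X]) (Q : ℝ[X]) :
    Set.EqOn (composeOps (fun k => weightedOp I p (polyAt x (P k))) (polyAt x Q))
      (polyAt x (polyCompose p P Q)) I := by
  induction n with
  | zero => intro t _; simp [composeOps, polyCompose_zero]
  | succ n ih =>
    intro t ht
    rw [composeOps_succ, weightedOp, iteratedDerivWithin_congr (ih fun k => P k.succ) ht,
      iteratedDerivWithin_polyAt hI x _ p ht, polyCompose_succ]
    simp [polyAt]

/-- The Taylor polynomial of order `m` of `g` at `x`, in powers of the increment. -/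
noncomputable def jetPoly (I : Set ℝ) (x : ℝ) (m : ℕ) (g : ℝ → ℝ) : ℝ[X] :=
  ∑ k ∈ Finset.range m, monomial k (iteratedDerivWithin k g I x / k.factorial)

lemma factorial_mul_coeff_jetPoly {m k : ℕ} (hk : k < m) :
    k.factorial * (jetPoly I x m g).coeff k = iteratedDerivWithin k g I x := by
  have : (k.factorial : ℝ) ≠ 0 := by exact_mod_cast k.factorial_ne_zero
  simp only [jetPoly, finsetSum_coeff, coeff_monomial, Finset.sum_ite_eq', Finset.mem_range,
    if_pos hk]
  field_simp

lemma jetEq_jetPoly (hI : UniqueDiffOn ℝ I) (hx : x ∈ I) (m : ℕ) (g : ℝ → ℝ) :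
    JetEq I x m g (polyAt x (jetPoly I x m g)) := fun k hk => by
  rw [iteratedDerivWithin_polyAt_self hI hx, factorial_mul_coeff_jetPoly hk]

/-- Only the value at `x` is wanted, a jet of length `1`, and the `2p` operators cost `p` orders
each; hence the bound on `m`. Centring at `x` turns evaluation into the coefficient of index `0`. -/
lemma alternatingComposition_eq (hI : UniqueDiffOn ℝ I) (hx : x ∈ I)
    {v : Fin (2 * p) → ℝ → ℝ} (hv : ∀ i, ContDiffOn ℝ ∞ (v i) I) (hg : ContDiffOn ℝ ∞ g I)
    {m : ℕ} (hm : 1 + 2 * p * p ≤ m) :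
    alternatingComposition I p v g x = ∑ σ : Equiv.Perm (Fin (2 * p)),
      ((Equiv.Perm.sign σ : ℤ) : ℝ) *
        (polyCompose p (fun k => jetPoly I x m (v (σ k))) (jetPoly I x m g)).coeff 0 := by
  refine Finset.sum_congr rfl fun σ _ => ?_
  have hP : ∀ P : ℝ[X], ContDiffOn ℝ ∞ (polyAt x P) I := fun P => (contDiff_polyAt x P).contDiffOn
  have hj : JetEq I x 1 _ _ := JetEq.composeOps (p := p) hI hx (fun k => hv (σ k))
    (fun k => hP (jetPoly I x m (v (σ k)))) hg (hP (jetPoly I x m g))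
    (fun k => (jetEq_jetPoly hI hx m _).mono hm) ((jetEq_jetPoly hI hx m _).mono hm)
  have h0 := hj 0 one_pos
  rw [iteratedDerivWithin_zero, iteratedDerivWithin_zero] at h0
  rw [h0, composeOps_polyAt hI x _ _ hx, polyAt, sub_self, coeff_zero_eq_eval_zero]

end AlternatingWronskian

/-! ### Alternating forms on polynomials, tested on monomials. -/

namespace AlternatingWronskian
open Polynomial Equiv

/-- The multilinear map `P ↦ (P₀ ∂ᵖ ∘ ⋯ ∘ Pₙ₋₁ ∂ᵖ (Q)) (0)`. -/
noncomputable def composeMultilinear (p n : ℕ) (Q : ℝ[X]) :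
    MultilinearMap ℝ (fun _ : Fin n => ℝ[X]) ℝ :=
  (lcoeff ℝ 0 ∘ₗ LinearMap.applyₗ Q).compMultilinearMap
    ((MultilinearMap.mkPiAlgebraFin ℝ n (Module.End ℝ ℝ[X])).compLinearMap fun _ => polyOp p)

lemma composeMultilinear_apply (p n : ℕ) (Q : ℝ[X]) (P : Fin n → ℝ[X]) :
    composeMultilinear p n Q P = (polyCompose p P Q).coeff 0 := by
  simp [composeMultilinear, polyCompose]

/-- The alternating composition of operators with polynomial coefficients, evaluated at `0`. -/
noncomputable def composeAlternating (p n : ℕ) (Q : ℝ[X]) : ℝ[X] [⋀^Fin n]→ₗ[ℝ] ℝ :=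
  MultilinearMap.alternatization (composeMultilinear p n Q)

lemma composeAlternating_apply (p n : ℕ) (Q : ℝ[X]) (P : Fin n → ℝ[X]) :
    composeAlternating p n Q P = ∑ σ : Perm (Fin n),
      ((Perm.sign σ : ℤ) : ℝ) * (polyCompose p (fun k => P (σ k)) Q).coeff 0 := by
  rw [composeAlternating, MultilinearMap.alternatization_apply]
  refine Finset.sum_congr rfl fun σ _ => ?_
  rw [MultilinearMap.domDomCongr_apply, composeMultilinear_apply, Units.smul_def, zsmul_eq_mul]

/-- The linear map sending a polynomial to its first `n` derivatives at `0`. -/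
noncomputable def jetMap (n : ℕ) : ℝ[X] →ₗ[ℝ] (Fin n → ℝ) :=
  LinearMap.pi fun i => (i : ℕ).factorial • lcoeff ℝ i

/-- The Wronskian of polynomials at `0`, as an alternating map. -/
noncomputable def wronskianAlternating (n : ℕ) : ℝ[X] [⋀^Fin n]→ₗ[ℝ] ℝ :=
  (Matrix.detRowAlternating (R := ℝ) (n := Fin n)).compLinearMap (jetMap n)

lemma wronskianAlternating_apply (n : ℕ) (P : Fin n → ℝ[X]) :
    wronskianAlternating n P =
      (Matrix.of fun i j : Fin n => ((i : ℕ).factorial : ℝ) * (P j).coeff i).det := by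
  rw [← Matrix.det_transpose]
  simp only [wronskianAlternating, AlternatingMap.compLinearMap_apply]
  change Matrix.det _ = _
  congr 1
  ext i j
  simp [jetMap]

/-- Degree count: the operator with coefficient `X ^ v k` shifts degrees by `v k - p`. -/
lemma coeff_polyCompose_monomial {p n : ℕ} (v : Fin n → ℕ) (b : ℕ) (r : ℝ) (e : ℕ)
    (h : (polyCompose p (fun k => monomial (v k) (1 : ℝ)) (monomial b r)).coeff e ≠ 0) :
    e + n * p = ∑ k, v k + b := by
  induction n generalizing e with
  | zero =>
    rw [polyCompose_zero, coeff_monomial] at h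
    simp only [ne_eq, ite_eq_right_iff, not_forall] at h
    simp [h.1]
  | succ n ih =>
    rw [polyCompose_succ, monomial_one_right_eq_X_pow, coeff_X_pow_mul'] at h
    split_ifs at h with hv
    · rw [coeff_iterate_derivative] at h
      have := ih (fun k => v k.succ) (e - v 0 + p) (right_ne_zero_of_smul h)
      rw [Fin.sum_univ_succ, add_mul]
      omega
    · exact absurd rfl h

lemma iterate_derivative_monomial (p b : ℕ) (r : ℝ) :
    derivative^[p] (monomial b r) = monomial (b - p) (r * b.descFactorial p) := by
  rw [← C_mul_X_pow_eq_monomial, iterate_derivative_C_mul, iterate_derivative_X_pow_eq_C_mul,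
    ← mul_assoc, ← C_mul, C_mul_X_pow_eq_monomial]

/-- The innermost operator already differentiates the monomial to zero; at least one operator is
needed. -/
lemma polyCompose_monomial_of_lt {p n b : ℕ} (hb : b < p) (P : Fin (n + 1) → ℝ[X]) (r : ℝ) :
    polyCompose p P (monomial b r) = 0 := by
  induction n with
  | zero =>
    rw [polyCompose_succ, polyCompose_zero, iterate_derivative_monomial,
      Nat.descFactorial_of_lt hb]
    simp
  | succ n ih => rw [polyCompose_succ, ih]; simp

/-- On monomials, the composition acts with a suffix weight as its coefficient. -/
lemma polyCompose_monomial {p n : ℕ} (v : Fin (n + 1) → ℕ) (r : ℝ) (hn : n < 2 * p) :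
    polyCompose p (fun k => monomial (v k) (1 : ℝ)) (monomial p r) =
      monomial (∑ k, v k - n * p)
        (r * p.factorial * suffixWeight (exponentWeight p) (List.ofFn fun k => v k.succ)) := by
  induction n with
  | zero =>
    rw [polyCompose_succ, polyCompose_zero, iterate_derivative_monomial, monomial_mul_monomial]
    simp [Nat.descFactorial_self, suffixWeight]
  | succ n ih =>
    rw [polyCompose_succ, ih (fun k => v k.succ) (by omega), iterate_derivative_monomial,
      monomial_mul_monomial, one_mul, List.ofFn_succ (f := fun k => v k.succ), suffixWeight,
      List.length_ofFn, List.sum_ofFn, Fin.sum_univ_succ (f := v)]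
    rw [← Fin.sum_univ_succ (f := fun k => v k.succ)]
    set m := ∑ k : Fin (n + 1), v k.succ
    rw [exponentWeight, if_pos hn, Nat.add_sub_cancel]
    have e : (n + 1) * p = n * p + p := by ring
    split_ifs with h
    · congr 1
      · congr 1
        omega
      · push_cast; ring
    -- When the filter fails, the current exponent is below `p` and `∂ᵖ` kills the monomial.
    · rw [Nat.descFactorial_of_lt (by omega)]
      simp

lemma suffixWeight_exponentWeight {p n : ℕ} (hn : n + 1 = 2 * p) (v : Fin (n + 1) → ℕ) :
    suffixWeight (exponentWeight p) (List.ofFn v) =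
      suffixWeight (exponentWeight p) (List.ofFn fun k => v k.succ) := by
  rw [List.ofFn_succ, suffixWeight, List.length_ofFn, exponentWeight, if_neg (by omega), one_mul]

lemma composeAlternating_monomial {p n : ℕ} (hn : n + 1 = 2 * p) (r : ℝ) :
    composeAlternating p (n + 1) (monomial p r) (fun k => monomial (k : ℕ) 1) =
      r * p.factorial *
        (permSum (MonoidHom.id ℤˣ) (exponentWeight p) (fun i : Fin (n + 1) => (i : ℕ)) : ℝ) := by
  rw [composeAlternating_apply, permSum, Int.cast_sum, Finset.mul_sum]
  refine Finset.sum_congr rfl fun σ _ => ?_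
  rw [polyCompose_monomial (fun k => (σ k : ℕ)) r (by omega), suffixWeight_exponentWeight hn]
  -- Here `n = 2p - 1`, and `0 + ⋯ + n = n p`, so the result of the composition is a constant.
  have hsum : ∑ k, (σ k : ℕ) - n * p = 0 := by
    rw [Equiv.sum_comp σ (fun k => (k : ℕ))]
    have h1 := two_mul_sum_fin (n + 1)
    have : (n + 1) * (n + 1 - 1) = n * p * 2 := by rw [Nat.add_sub_cancel, hn]; ring
    omega
  rw [hsum, coeff_monomial_same, MonoidHom.id_apply]
  push_cast
  ring

lemma wronskianAlternating_monomial (n : ℕ) :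
    wronskianAlternating n (fun k => monomial (k : ℕ) 1) =
      ((∏ k ∈ Finset.range n, k.factorial : ℕ) : ℝ) := by
  rw [wronskianAlternating_apply]
  have : (Matrix.of fun i j : Fin n =>
      ((i : ℕ).factorial : ℝ) * (monomial (j : ℕ) (1 : ℝ)).coeff i) =
      Matrix.diagonal fun i : Fin n => ((i : ℕ).factorial : ℝ) := by
    ext i j
    rw [Matrix.of_apply, Matrix.diagonal_apply, coeff_monomial]
    by_cases h : i = j
    · simp [h]
    · rw [if_neg (fun h' => h (Fin.ext h'.symm)), if_neg h, mul_zero]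
  rw [this, Matrix.det_diagonal, Fin.prod_univ_eq_prod_range fun i => ((i : ℕ).factorial : ℝ)]
  push_cast
  rfl

/-- Induction by removing the maximum, which is at least `s.card - 1`. -/
lemma sum_range_card_le (s : Finset ℕ) : ∑ i ∈ Finset.range s.card, i ≤ ∑ i ∈ s, i := by
  induction h : s.card generalizing s with
  | zero => simp
  | succ n ih =>
    have hs : s.Nonempty := Finset.card_pos.1 (by omega)
    have hm := s.max'_mem hs
    have hc : (s.erase (s.max' hs)).card = n := by rw [Finset.card_erase_of_mem hm]; omega
    have hle : n ≤ s.max' hs := by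
      have : s ⊆ Finset.range (s.max' hs + 1) := fun i hi =>
        Finset.mem_range.2 (Nat.lt_succ_of_le (s.le_max' i hi))
      have := Finset.card_le_card this
      rw [Finset.card_range] at this
      omega
    rw [← Finset.sum_erase_add _ _ hm, Finset.sum_range_succ]
    exact add_le_add (ih _ hc) hle

/-- Distinct natural numbers, one of them large, have a large sum. -/
lemma sum_fin_lt_of_injective {n : ℕ} {v : Fin (n + 1) → ℕ} (hv : Function.Injective v)
    {j : Fin (n + 1)} (hj : n + 1 ≤ v j) : ∑ i : Fin (n + 1), (i : ℕ) < ∑ i, v i := by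
  have h := sum_range_card_le ((Finset.univ.erase j).image v)
  rw [Finset.card_image_of_injective _ hv, Finset.sum_image hv.injOn,
    Finset.card_erase_of_mem (Finset.mem_univ j), Finset.card_univ, Fintype.card_fin,
    Nat.add_sub_cancel] at h
  rw [Fin.sum_univ_eq_sum_range (fun i => i), Finset.sum_range_succ,
    ← Finset.sum_erase_add _ _ (Finset.mem_univ j)]
  omega

/-- An injective family either has a large value or is a permutation. -/
lemma exists_le_or_perm {n : ℕ} {v : Fin n → ℕ} (hv : Function.Injective v) :
    (∃ j, n ≤ v j) ∨ ∃ τ : Perm (Fin n), v = fun i => (τ i : ℕ) := by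
  by_cases h : ∃ j, n ≤ v j
  · exact Or.inl h
  · push Not at h
    refine Or.inr ⟨Equiv.ofBijective (fun i => ⟨v i, h i⟩)
      (Finite.injective_iff_bijective.1 fun i j hij => hv (by simpa using hij)), ?_⟩
    rfl

/-- The universal constant, as a quotient of integers. -/
noncomputable def alternationConst (p : ℕ) : ℝ :=
  (permSum (MonoidHom.id ℤˣ) (exponentWeight p) (fun i : Fin (2 * p) => (i : ℕ)) : ℝ) /
    ((∏ k ∈ Finset.range (2 * p), k.factorial : ℕ) : ℝ)

/-- Both sides are alternating, so injective families of monomials suffice. Outside permutations of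
`0, …, N - 1` both sides vanish; on permutations both change by the sign, and the standard order
remains. -/
lemma composeAlternating_eq_monomial {p : ℕ} (hp : 1 ≤ p) (b : ℕ) (r : ℝ) :
    composeAlternating p (2 * p) (monomial b r) =
      (alternationConst p * (p.factorial * (monomial b r).coeff p)) •
        wronskianAlternating (2 * p) := by
  rw [alternationConst]
  generalize hN : 2 * p = N
  obtain ⟨n, rfl⟩ : ∃ n, N = n + 1 := ⟨N - 1, by omega⟩
  have hn := hN.symm
  refine (basisMonomials ℝ).ext_alternating fun v hv => ?_
  simp only [coe_basisMonomials, AlternatingMap.smul_apply]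
  have hsum := two_mul_sum_fin (n + 1)
  rw [Nat.add_sub_cancel] at hsum
  have hpn : (n + 1) * n = 2 * (n * p) := by rw [hn]; ring
  have hlast : (n + 1) * p = n * p + p := by ring
  have hzero : ∀ w : Fin (n + 1) → ℕ, (n + 1) * p ≠ ∑ k, w k + b →
      composeAlternating p (n + 1) (monomial b r) (fun k => monomial (w k) 1) = 0 := by
    intro w hw
    rw [composeAlternating_apply]
    refine Finset.sum_eq_zero fun σ _ => ?_
    by_contra hne
    have := coeff_polyCompose_monomial _ _ _ _ (right_ne_zero_of_mul hne)
    rw [zero_add, Equiv.sum_comp σ w] at this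
    exact hw this
  rcases exists_le_or_perm hv with ⟨j, hj⟩ | ⟨τ, rfl⟩
  · have hw : wronskianAlternating (n + 1) (fun i => monomial (v i) 1) = 0 := by
      rw [wronskianAlternating_apply]
      refine Matrix.det_eq_zero_of_column_eq_zero j fun i => ?_
      -- The exponent `v j` exceeds every row index, so column `j` of the Wronskian matrix vanishes
      -- at `0`.
      rw [Matrix.of_apply, coeff_monomial, if_neg (by have := i.2; omega), mul_zero]
    rw [hw, smul_zero]
    by_cases hb : b < p
    · rw [composeAlternating_apply]
      refine Finset.sum_eq_zero fun σ _ => ?_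
      rw [polyCompose_monomial_of_lt hb, coeff_zero, mul_zero]
    -- Now `b ≥ p` and `∑ v i > n p`, so the total degree is too large.
    · have := sum_fin_lt_of_injective hv hj
      exact hzero v (by omega)
  · have hperm := fun f : ℝ[X] [⋀^Fin (n + 1)]→ₗ[ℝ] ℝ =>
      f.map_perm (fun k : Fin (n + 1) => monomial (k : ℕ) (1 : ℝ)) τ
    simp only [Function.comp_def] at hperm
    rw [hperm, hperm, smul_comm]
    congr 1
    by_cases hb : b = p
    · subst hb
      rw [composeAlternating_monomial hn, wronskianAlternating_monomial, coeff_monomial_same,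
        smul_eq_mul]
      have h0 : ((∏ k ∈ Finset.range (n + 1), k.factorial : ℕ) : ℝ) ≠ 0 := by
        exact_mod_cast (Finset.prod_pos fun k _ => Nat.factorial_pos k).ne'
      field_simp
    · rw [coeff_monomial, if_neg hb, mul_zero, mul_zero, zero_smul]
      -- The exponents sum to exactly `n p`, so the degree balance would force `b = p`.
      exact hzero _ (by omega)

lemma composeAlternating_eq {p : ℕ} (hp : 1 ≤ p) (Q : ℝ[X]) (P : Fin (2 * p) → ℝ[X]) :
    composeAlternating p (2 * p) Q P =
      alternationConst p * wronskianAlternating (2 * p) P * (p.factorial * Q.coeff p) := by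
  induction Q using Polynomial.induction_on' with
  | add Q R hQ hR =>
    have hadd : composeAlternating p (2 * p) (Q + R) P =
        composeAlternating p (2 * p) Q P + composeAlternating p (2 * p) R P := by
      simp only [composeAlternating_apply, polyCompose, map_add, coeff_add, mul_add,
        Finset.sum_add_distrib]
    rw [hadd, hQ, hR, coeff_add]
    ring
  | monomial b r =>
    rw [composeAlternating_eq_monomial hp, AlternatingMap.smul_apply, smul_eq_mul]
    ring

/-! ### Existence and uniqueness of the constant. -/

variable {I : Set ℝ} {p : ℕ}

lemma isAlternationConst_alternationConst (hI : UniqueDiffOn ℝ I) (hp : 1 ≤ p) :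
    IsAlternationConst I p (alternationConst p) := by
  intro w hw f hf x hx
  -- Long enough for the jet reduction, for `∂ᵖ f`, and for all rows of the Wronskian.
  obtain ⟨m, hm⟩ : ∃ m, m = 1 + 2 * p * p + p := ⟨_, rfl⟩
  have h2 : 2 * p ≤ 2 * p * p := Nat.le_mul_of_pos_right _ hp
  rw [alternatingComposition_eq hI hx hw hf (m := m) (by omega),
    ← composeAlternating_apply p (2 * p) _ fun k => jetPoly I x m (w k),
    composeAlternating_eq hp, factorial_mul_coeff_jetPoly (by omega), wronskianAlternating_apply,
    wronskian]
  congr 3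
  ext i j
  rw [Matrix.of_apply, Matrix.of_apply, factorial_mul_coeff_jetPoly (by have := i.2; omega)]

/-- Uniqueness is tested at one point `x` on the powers of `t - x`, where the Wronskian and `∂ᵖ f`
are products of factorials, hence nonzero. -/
lemma isAlternationConst_iff (hI : UniqueDiffOn ℝ I) (hne : I.Nonempty) (hp : 1 ≤ p) (c : ℝ) :
    IsAlternationConst I p c ↔ c = alternationConst p := by
  have hex := isAlternationConst_alternationConst hI hp
  refine ⟨fun hc => ?_, fun h => h ▸ hex⟩
  obtain ⟨x, hx⟩ := hne
  have hP : ∀ P : ℝ[X], ContDiffOn ℝ ∞ (polyAt x P) I := fun P => (contDiff_polyAt x P).contDiffOn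
  have h1 := hc _ (fun i => hP (monomial (i : ℕ) 1)) _ (hP (monomial p 1)) x hx
  rw [hex _ (fun i => hP (monomial (i : ℕ) 1)) _ (hP (monomial p 1)) x hx] at h1
  have hw : wronskian I (fun i : Fin (2 * p) => polyAt x (monomial (i : ℕ) 1)) x ≠ 0 := by
    rw [wronskian]
    simp only [iteratedDerivWithin_polyAt_self hI hx]
    rw [← wronskianAlternating_apply _ fun k : Fin (2 * p) => monomial (k : ℕ) (1 : ℝ),
      wronskianAlternating_monomial]
    exact_mod_cast (Finset.prod_pos fun k _ => Nat.factorial_pos k).ne'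
  have hf : iteratedDerivWithin p (polyAt x (monomial p 1)) I x ≠ 0 := by
    rw [iteratedDerivWithin_polyAt_self hI hx, coeff_monomial_same, mul_one]
    exact_mod_cast p.factorial_ne_zero
  exact (mul_right_cancel₀ hw (mul_right_cancel₀ hf h1)).symm

lemma alternationConst_eq_closedFormula (hp : 1 ≤ p) : alternationConst p = closedFormula p := by
  rw [alternationConst, permSum_exponentWeight hp, closedFormula]
  push_cast
  rfl

lemma isAlternationConst_iff_closedFormula (hI : I.OrdConnected) (hne : (interior I).Nonempty)
    (hp : 1 ≤ p) (c : ℝ) : IsAlternationConst I p c ↔ c = closedFormula p := by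
  rw [isAlternationConst_iff (uniqueDiffOn_convex hI.convex hne) (hne.mono interior_subset) hp,
    alternationConst_eq_closedFormula hp]

end AlternatingWronskian

/-! ### Kernel evaluation of the trees for `p = 1, …, 6`. -/

namespace AlternatingWronskian

lemma closedFormula_one : closedFormula 1 = 1 := by
  exact_mod_cast closedFormula_eq (c := 1) le_rfl (by decide +kernel)

lemma closedFormula_two : closedFormula 2 = 2 := by
  exact_mod_cast closedFormula_eq (c := 2) (p := 2) (by norm_num) (by decide +kernel)

lemma closedFormula_three : closedFormula 3 = 90 := by
  exact_mod_cast closedFormula_eq (c := 90) (p := 3) (by norm_num) (by decide +kernel)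

lemma closedFormula_four : closedFormula 4 = 586656 := by
  exact_mod_cast closedFormula_eq (c := 586656) (p := 4) (by norm_num) (by decide +kernel)

lemma closedFormula_five : closedFormula 5 = 1915103977500 := by
  exact_mod_cast closedFormula_eq (c := 1915103977500) (p := 5) (by norm_num) (by decide +kernel)

lemma closedFormula_six : closedFormula 6 = 7886133184567796056800 := by
  exact_mod_cast closedFormula_eq (c := 7886133184567796056800) (p := 6) (by norm_num)
    (by decide +kernel)

lemma card_phi_one : (Phi 1).card = 1 ∧ (evenPhi 1).card = 1 ∧ (oddPhi 1).card = 0 :=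
  card_phi_eq (a := 1) (b := 0) le_rfl (by decide +kernel) (by decide +kernel)

lemma card_phi_two : (Phi 2).card = 3 ∧ (evenPhi 2).card = 1 ∧ (oddPhi 2).card = 2 :=
  card_phi_eq (a := 1) (b := 2) (by norm_num) (by decide +kernel) (by decide +kernel)

lemma card_phi_three : (Phi 3).card = 35 ∧ (evenPhi 3).card = 18 ∧ (oddPhi 3).card = 17 :=
  card_phi_eq (a := 18) (b := 17) (by norm_num) (by decide +kernel) (by decide +kernel)

lemma card_phi_four : (Phi 4).card = 1001 ∧ (evenPhi 4).card = 500 ∧ (oddPhi 4).card = 501 :=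
  card_phi_eq (a := 500) (b := 501) (by norm_num) (by decide +kernel) (by decide +kernel)

lemma card_phi_five :
    (Phi 5).card = 53109 ∧ (evenPhi 5).card = 26555 ∧ (oddPhi 5).card = 26554 :=
  card_phi_eq (a := 26555) (b := 26554) (by norm_num) (by decide +kernel) (by decide +kernel)

lemma card_phi_six :
    (Phi 6).card = 4605271 ∧ (evenPhi 6).card = 2302635 ∧ (oddPhi 6).card = 2302636 :=
  card_phi_eq (a := 2302635) (b := 2302636) (by norm_num) (by decide +kernel) (by decide +kernel)

lemma isAlternationConst_iff_of_closedFormula_eq {I : Set ℝ} (hI : I.OrdConnected)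
    (hne : (interior I).Nonempty) {p : ℕ} (hp : 1 ≤ p) {q : ℚ} (hq : closedFormula p = q) (c : ℝ) :
    IsAlternationConst I p c ↔ c = q := by
  rw [isAlternationConst_iff_closedFormula hI hne hp, hq]

end AlternatingWronskian

theorem mainTheorem2 (I : Set ℝ) (hI : I.OrdConnected) (hne : (interior I).Nonempty) :
    -- existence, uniqueness and value of the universal constant for `p = 1, …, 6`
    ((∀ c : ℝ, AlternatingWronskian.IsAlternationConst I 1 c ↔ c = 1) ∧
      (∀ c : ℝ, AlternatingWronskian.IsAlternationConst I 2 c ↔ c = 2) ∧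
      (∀ c : ℝ, AlternatingWronskian.IsAlternationConst I 3 c ↔ c = 90) ∧
      (∀ c : ℝ, AlternatingWronskian.IsAlternationConst I 4 c ↔ c = 586656) ∧
      (∀ c : ℝ, AlternatingWronskian.IsAlternationConst I 5 c ↔ c = 1915103977500) ∧
      (∀ c : ℝ, AlternatingWronskian.IsAlternationConst I 6 c ↔ c = 7886133184567796056800)) ∧
    -- the closed formula over `Φ_p` evaluates to these values
    (AlternatingWronskian.closedFormula 1 = 1 ∧
      AlternatingWronskian.closedFormula 2 = 2 ∧
      AlternatingWronskian.closedFormula 3 = 90 ∧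
      AlternatingWronskian.closedFormula 4 = 586656 ∧
      AlternatingWronskian.closedFormula 5 = 1915103977500 ∧
      AlternatingWronskian.closedFormula 6 = 7886133184567796056800) ∧
    -- the sizes of `Φ_p`
    ((AlternatingWronskian.Phi 1).card = 1 ∧
      (AlternatingWronskian.Phi 2).card = 3 ∧
      (AlternatingWronskian.Phi 3).card = 35 ∧
      (AlternatingWronskian.Phi 4).card = 1001 ∧
      (AlternatingWronskian.Phi 5).card = 53109 ∧
      (AlternatingWronskian.Phi 6).card = 4605271) ∧
    -- the numbers of even permutations in `Φ_p`
    ((AlternatingWronskian.evenPhi 1).card = 1 ∧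
      (AlternatingWronskian.evenPhi 2).card = 1 ∧
      (AlternatingWronskian.evenPhi 3).card = 18 ∧
      (AlternatingWronskian.evenPhi 4).card = 500 ∧
      (AlternatingWronskian.evenPhi 5).card = 26555 ∧
      (AlternatingWronskian.evenPhi 6).card = 2302635) ∧
    -- the numbers of odd permutations in `Φ_p`
    ((AlternatingWronskian.oddPhi 1).card = 0 ∧
      (AlternatingWronskian.oddPhi 2).card = 2 ∧
      (AlternatingWronskian.oddPhi 3).card = 17 ∧
      (AlternatingWronskian.oddPhi 4).card = 501 ∧
      (AlternatingWronskian.oddPhi 5).card = 26554 ∧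
      (AlternatingWronskian.oddPhi 6).card = 2302636) := by
  open AlternatingWronskian in
  refine ⟨⟨fun c => ?_, fun c => ?_, fun c => ?_, fun c => ?_, fun c => ?_, fun c => ?_⟩,
    ⟨closedFormula_one, closedFormula_two, closedFormula_three, closedFormula_four,
      closedFormula_five, closedFormula_six⟩,
    ⟨card_phi_one.1, card_phi_two.1, card_phi_three.1, card_phi_four.1, card_phi_five.1,
      card_phi_six.1⟩,
    ⟨card_phi_one.2.1, card_phi_two.2.1, card_phi_three.2.1, card_phi_four.2.1,
      card_phi_five.2.1, card_phi_six.2.1⟩,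
    ⟨card_phi_one.2.2, card_phi_two.2.2, card_phi_three.2.2, card_phi_four.2.2,
      card_phi_five.2.2, card_phi_six.2.2⟩⟩
  · simpa using isAlternationConst_iff_of_closedFormula_eq hI hne le_rfl closedFormula_one c
  · simpa using isAlternationConst_iff_of_closedFormula_eq hI hne (by norm_num) closedFormula_two c
  · simpa using
      isAlternationConst_iff_of_closedFormula_eq hI hne (by norm_num) closedFormula_three c
  · simpa using isAlternationConst_iff_of_closedFormula_eq hI hne (by norm_num) closedFormula_four c
  · simpa using isAlternationConst_iff_of_closedFormula_eq hI hne (by norm_num) closedFormula_five c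
  · simpa using isAlternationConst_iff_of_closedFormula_eq hI hne (by norm_num) closedFormula_six c
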